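/- Let $k$ be a field, $S=k[x_1,\dots,x_n]$ with the standard grading, and let $I\subset S$ be a Borel fixed ideal, i.e. a monomial ideal such that whenever $\mathsf m\in I$ is a monomial, $x_i\mid \mathsf m$ and $j<i$, then $(x_j/x_i)\,\mathsf m\in I$. Let $G(I)$ be the set of minimal monomial generators of $I$. Let $(a_i)_{i\ge 0}$ be a non-decreasing sequence of non-negative integers with $a_0=0$. For a monomial $\mathsf m=\prod_{i=1}^e x_{\alpha_i}$ with $1\le\alpha_1\le\cdots\le\alpha_e\le n$ put $\mathsf m^{\sigma(a)}:=\prod_{i=1}^e x_{\alpha_i+a_{i-1}}$, let $T=k[x_1,\dots,x_N]$ with $N$ so large that $\mathsf m^{\sigma(a)}\in T$ for all $\mathsf m\in G(I)$, and let $I^{\sigma(a)}:=(\,\mathsf m^{\sigma(a)}\mid \mathsf m\in G(I)\,)\subset T$. Then the graded Betti numbers (the multiplicities of $S(-j)$, respectively $T(-j)$, in the $i$-th module of the minimal graded free resolution) satisfy $$\beta^S_{i,j}(I)=\beta^T_{i,j}(I^{\sigma(a)})\qquad\text{for all } i\ge 0 \text{ and } j\in\mathbb Z.$$ In particular, this holds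 for the Aramova–Herzog–Hibi squarefree operation $I\mapsto I^{\sigma}$, which is the case $a_i=i$ for all $i$. -/

import Mathlib

open MvPolynomial

noncomputable section

namespace BorelFixed

variable {σ : Type*} {k : Type*} [Field k]

/-- `I` is a monomial ideal: it is generated by monomials. -/
def IsMonomialIdeal (I : Ideal (MvPolynomial σ k)) : Prop :=
  ∃ A : Set (σ →₀ ℕ), I = Ideal.span ((fun m => monomial m (1 : k)) '' A)

/-- A monomial ideal `I` of `k[x_0, …, x_{n-1}]` is Borel fixed (strongly stable) if for every
monomial `m ∈ I`, every `x_i` dividing `m` and every `j < i`, also `(x_j / x_i) * m ∈ I`. -/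
def IsBorelFixed {n : ℕ} (I : Ideal (MvPolynomial (Fin n) k)) : Prop :=
  IsMonomialIdeal I ∧
    ∀ m : Fin n →₀ ℕ, monomial m (1 : k) ∈ I → ∀ i j : Fin n, m i ≠ 0 → j < i →
      monomial (m - Finsupp.single i 1 + Finsupp.single j 1) (1 : k) ∈ I

/-- `G(I)`: the (exponent vectors of the) minimal monomial generators of a monomial ideal, i.e. the
monomials of `I` that are minimal with respect to divisibility. -/
def minGens (I : Ideal (MvPolynomial σ k)) : Set (σ →₀ ℕ) :=
  {m | Minimal (fun m' : σ →₀ ℕ => monomial m' (1 : k) ∈ I) m}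

/-- The sequence `α_0 ≤ α_1 ≤ ⋯ ≤ α_{e-1}` with `m = ∏ x_{α_i}`. -/
def sortedVars {n : ℕ} (m : Fin n →₀ ℕ) : List (Fin n) :=
  (Finsupp.toMultiset m).sort (· ≤ ·)

/-- The exponent vector of `m^{σ(a)}`. Variables and positions are numbered from `0`, so
`m = ∏_{i < e} x_{α_i}` with `α_0 ≤ ⋯ ≤ α_{e-1}` is sent to `∏_{i < e} x_{α_i + a_i}`; the value is
an exponent vector in the variables `x_0, x_1, x_2, …`. -/
def shiftExp {n : ℕ} (a : ℕ → ℕ) (m : Fin n →₀ ℕ) : ℕ →₀ ℕ :=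
  ∑ i : Fin (sortedVars m).length,
    Finsupp.single (((sortedVars m).get i : ℕ) + a (i : ℕ)) 1

/-- The ring `T = k[x_0, …, x_{N-1}]` has enough variables: all the monomials `m^{σ(a)}`,
`m ∈ G(I)`, involve only variables of `T`. -/
def EnoughVars {n : ℕ} (a : ℕ → ℕ) (I : Ideal (MvPolynomial (Fin n) k)) (N : ℕ) : Prop :=
  ∀ m ∈ minGens I, ∀ v ∈ (shiftExp a m).support, v < N

/-- The ideal `I^{σ(a)} = (m^{σ(a)} | m ∈ G(I))` of `T = k[x_0, …, x_{N-1}]`, to be used when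
`EnoughVars a I N` holds. A monomial of `T` with exponent vector `t` is identified with the one in
the variables `x_0, x_1, …` whose exponent vector is `t` extended by zero. -/
def shiftIdeal {n : ℕ} (a : ℕ → ℕ) (N : ℕ) (I : Ideal (MvPolynomial (Fin n) k)) :
    Ideal (MvPolynomial (Fin N) k) :=
  Ideal.span {f | ∃ m ∈ minGens I, ∃ t : Fin N →₀ ℕ,
    Finsupp.mapDomain Fin.val t = shiftExp a m ∧ f = monomial t 1}

/-- The Aramova–Herzog–Hibi squarefree operation `I^σ`, the case `a_i = i`. -/
def squarefreeIdeal {n : ℕ} (N : ℕ) (I : Ideal (MvPolynomial (Fin n) k)) :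
    Ideal (MvPolynomial (Fin N) k) :=
  shiftIdeal (fun i => i) N I

/-- `f` is zero or homogeneous of degree `e` for the standard grading; here `e` is an integer, so
that `f = 0` is forced if `e < 0`. -/
def IsHomogeneousInt (f : MvPolynomial σ k) (e : ℤ) : Prop :=
  ∀ s ∈ f.support, ((s.degree : ℕ) : ℤ) = e

/-- A minimal graded free resolution `⋯ → F_2 → F_1 → F_0 → I → 0` over the standard graded ring
`R = k[x_s | s ∈ σ]` of an ideal `I`. Here `F_i` is the free `R`-module on the finite set `gens i`,
whose element `g` has degree `deg i g`, i.e. `F_i = ⊕_g R(-deg i g)`. -/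
structure MinimalGradedFreeResolution (I : Ideal (MvPolynomial σ k)) where
  gens : ℕ → Type
  finite_gens : ∀ i, Finite (gens i)
  deg : ∀ i, gens i → ℤ
  /-- the augmentation `F_0 → R`, with image `I` -/
  aug : (gens 0 →₀ MvPolynomial σ k) →ₗ[MvPolynomial σ k] MvPolynomial σ k
  /-- the differential `F_{i+1} → F_i` -/
  d : ∀ i, (gens (i + 1) →₀ MvPolynomial σ k) →ₗ[MvPolynomial σ k] (gens i →₀ MvPolynomial σ k)
  range_aug : LinearMap.range aug = I
  exact_zero : Function.Exact (d 0) aug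
  exact_succ : ∀ i, Function.Exact (d (i + 1)) (d i)
  /-- the augmentation preserves degrees -/
  aug_homogeneous : ∀ g, IsHomogeneousInt (aug (Finsupp.single g 1)) (deg 0 g)
  /-- the differentials preserve degrees -/
  d_homogeneous : ∀ i g h,
    IsHomogeneousInt (d i (Finsupp.single g 1) h) (deg (i + 1) g - deg i h)
  /-- minimality: the entries of the matrices of the differentials lie in the ideal generated by
  the variables -/
  d_minimal : ∀ i g h, constantCoeff (d i (Finsupp.single g 1) h) = 0

/-- The multiplicity of `R(-j)` in `F_i`. -/
def MinimalGradedFreeResolution.betti {I : Ideal (MvPolynomial σ k)}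
    (F : MinimalGradedFreeResolution I) (i : ℕ) (j : ℤ) : ℕ :=
  Nat.card {g : F.gens i // F.deg i g = j}

open Classical in
/-- The graded Betti number `β_{i,j}(I)`: the multiplicity of `R(-j)` in the `i`-th module of a
minimal graded free resolution of `I`. (A minimal graded free resolution of a homogeneous ideal in
finitely many variables exists and is unique up to isomorphism; the value for an ideal without such
a resolution is irrelevant.) -/
def gradedBetti (I : Ideal (MvPolynomial σ k)) (i : ℕ) (j : ℤ) : ℕ :=
  if h : Nonempty (MinimalGradedFreeResolution I) then (Classical.choice h).betti i j else 0

end BorelFixed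

end

noncomputable section

namespace BorelFixed

variable {σ : Type*} {k : Type*} [Field k]

/-! ### Homogeneous polynomials with integer degrees -/

/-! Every `I^{σ(a)}` has linear quotients with the same numerical data as `I`. Order the minimal
generators by degree, then lexicographically on their sorted words (`genKey`). The colon of the
ideal of earlier shifted generators by `m^{σ(a)}` is generated by variables: for each `j` below the
last letter of `m`, take the first position `l` whose letter exceeds `j`; this gives `x_{j + a_l}`.
These variables are distinct because `a` is monotone, so their number is the last letter of `m`,
whatever `a` is.

Adding one generator at a time, the mapping cone over the Koszul-type resolution of the colon ideal
is minimal for degree reasons. Hence `β_{i,j}` is the sum of `binom(last letter of m, i)` over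
generators `m` of degree `j - i`, the Eliahou–Kervaire formula. It does not mention `a`, and `a = 0`
gives back `I`.

The combinatorial core is `IsBorelFixed.exists_first_drop` and `shiftCount_lt_of_first_drop` (the
colon is no larger) and `IsBorelFixed.exists_earlier_gen` (it is no smaller). The algebraic core is
`HasBetti.sup_monomial`, with `MinimalGradedFreeResolution.betti_eq` making the chosen resolution
irrelevant. -/

lemma IsHomogeneousInt.zero (e : ℤ) : IsHomogeneousInt (0 : MvPolynomial σ k) e := by
  simp [IsHomogeneousInt]

lemma isHomogeneousInt_iff_coeff {f : MvPolynomial σ k} {e : ℤ} :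
    IsHomogeneousInt f e ↔ ∀ s, coeff s f ≠ 0 → ((s.degree : ℕ) : ℤ) = e := by
  simp [IsHomogeneousInt, mem_support_iff]

lemma isHomogeneousInt_monomial (s : σ →₀ ℕ) (c : k) :
    IsHomogeneousInt (monomial s c) (s.degree : ℤ) := by
  classical
  rw [isHomogeneousInt_iff_coeff]
  intro t ht
  rw [coeff_monomial] at ht
  split_ifs at ht with h
  · rw [h]
  · exact absurd rfl ht

lemma isHomogeneousInt_one : IsHomogeneousInt (1 : MvPolynomial σ k) 0 := by
  simpa using isHomogeneousInt_monomial (0 : σ →₀ ℕ) (1 : k)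

lemma isHomogeneousInt_X (v : σ) : IsHomogeneousInt (X v : MvPolynomial σ k) 1 := by
  simpa [X] using isHomogeneousInt_monomial (Finsupp.single v 1) (1 : k)

lemma IsHomogeneousInt.mul {f g : MvPolynomial σ k} {e c : ℤ} (hf : IsHomogeneousInt f e)
    (hg : IsHomogeneousInt g c) : IsHomogeneousInt (f * g) (e + c) := by
  classical
  rw [isHomogeneousInt_iff_coeff] at *
  intro s hs
  rw [coeff_mul] at hs
  obtain ⟨x, hx, hne⟩ := Finset.exists_ne_zero_of_sum_ne_zero hs
  rw [← hf _ (left_ne_zero_of_mul hne), ← hg _ (right_ne_zero_of_mul hne),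
    ← Finset.HasAntidiagonal.mem_antidiagonal.1 hx, map_add, Nat.cast_add]

lemma IsHomogeneousInt.neg {f : MvPolynomial σ k} {e : ℤ} (hf : IsHomogeneousInt f e) :
    IsHomogeneousInt (-f) e := by
  rw [isHomogeneousInt_iff_coeff] at *
  intro s hs
  exact hf s (by simpa using hs)

lemma IsHomogeneousInt.sum {ι : Type*} (s : Finset ι) (f : ι → MvPolynomial σ k) {e : ℤ}
    (hf : ∀ i ∈ s, IsHomogeneousInt (f i) e) : IsHomogeneousInt (∑ i ∈ s, f i) e := by
  simp only [isHomogeneousInt_iff_coeff] at *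
  intro t ht
  rw [coeff_sum] at ht
  obtain ⟨i, hi, hne⟩ := Finset.exists_ne_zero_of_sum_ne_zero ht
  exact hf i hi t hne

lemma IsHomogeneousInt.constantCoeff_eq_zero {f : MvPolynomial σ k} {e : ℤ}
    (hf : IsHomogeneousInt f e) (he : e ≠ 0) : constantCoeff f = 0 := by
  by_contra h
  rw [isHomogeneousInt_iff_coeff] at hf
  exact he (by simpa using (hf 0 (by simpa [constantCoeff_eq] using h)).symm)

/-- The homogeneous component of integer degree `e`. -/
def componentInt (e : ℤ) : MvPolynomial σ k →ₗ[k] MvPolynomial σ k :=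
  if 0 ≤ e then homogeneousComponent e.toNat else 0

lemma coeff_componentInt (e : ℤ) (f : MvPolynomial σ k) (s : σ →₀ ℕ) :
    coeff s (componentInt e f) = if ((s.degree : ℕ) : ℤ) = e then coeff s f else 0 := by
  unfold componentInt
  by_cases he : 0 ≤ e
  · rw [if_pos he, coeff_homogeneousComponent]
    congr 1
    exact propext ⟨fun h => by omega, fun h => by omega⟩
  · rw [if_neg he, if_neg (by omega)]
    simp

lemma isHomogeneousInt_componentInt (e : ℤ) (f : MvPolynomial σ k) :
    IsHomogeneousInt (componentInt e f) e := by
  rw [isHomogeneousInt_iff_coeff]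
  intro s hs
  rw [coeff_componentInt] at hs
  by_contra h
  exact hs (if_neg h)

lemma IsHomogeneousInt.componentInt_eq {f : MvPolynomial σ k} {e : ℤ}
    (hf : IsHomogeneousInt f e) : componentInt e f = f := by
  ext s
  rw [coeff_componentInt]
  split_ifs with h
  · rfl
  · by_contra hne
    exact h (isHomogeneousInt_iff_coeff.1 hf s (Ne.symm hne))

lemma componentInt_mul {f g : MvPolynomial σ k} {c : ℤ} (e : ℤ) (hg : IsHomogeneousInt g c) :
    componentInt e (f * g) = componentInt (e - c) f * g := by
  classical
  ext s
  rw [coeff_componentInt, coeff_mul, coeff_mul, Finset.ite_sum_zero]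
  refine Finset.sum_congr rfl fun x hx => ?_
  rw [coeff_componentInt]
  by_cases hx2 : coeff x.2 g = 0
  · simp [hx2]
  · have h1 := isHomogeneousInt_iff_coeff.1 hg _ hx2
    have h2 : (s.degree : ℤ) = x.1.degree + x.2.degree := by
      rw [← Finset.HasAntidiagonal.mem_antidiagonal.1 hx, map_add, Nat.cast_add]
    by_cases h : ((x.1.degree : ℕ) : ℤ) = e - c
    · rw [if_pos h, if_pos (by omega)]
    · rw [if_neg h, if_neg (by omega), zero_mul]

/-! ### Graded maps of free modules -/

/-- A linear map between free modules whose matrix has homogeneous entries of the degrees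
required for it to preserve degrees. -/
def IsGradedMap {A B : Type*} (dA : A → ℤ) (dB : B → ℤ)
    (f : (A →₀ MvPolynomial σ k) →ₗ[MvPolynomial σ k] (B →₀ MvPolynomial σ k)) : Prop :=
  ∀ g h, IsHomogeneousInt (f (Finsupp.single g 1) h) (dA g - dB h)

lemma linearMap_apply_eq_sum {R A M : Type*} [CommRing R] [AddCommGroup M] [Module R M]
    [Fintype A] (f : (A →₀ R) →ₗ[R] M) (y : A →₀ R) :
    f y = ∑ g, y g • f (Finsupp.single g 1) := by
  conv_lhs => rw [← Finsupp.univ_sum_single y]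
  rw [map_sum]
  refine Finset.sum_congr rfl fun g _ => ?_
  rw [← map_smul, Finsupp.smul_single, smul_eq_mul, mul_one]

lemma linearMap_apply_apply_eq_sum {R A B : Type*} [CommRing R]
    [Fintype A] (f : (A →₀ R) →ₗ[R] (B →₀ R)) (y : A →₀ R) (h : B) :
    f y h = ∑ g, y g * f (Finsupp.single g 1) h := by
  rw [linearMap_apply_eq_sum f y, Finsupp.finsetSum_apply]
  rfl

lemma IsGradedMap.comp {A B C : Type*} [Finite B] {dA : A → ℤ} {dB : B → ℤ} {dC : C → ℤ}
    {f : (B →₀ MvPolynomial σ k) →ₗ[MvPolynomial σ k] (C →₀ MvPolynomial σ k)}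
    {g : (A →₀ MvPolynomial σ k) →ₗ[MvPolynomial σ k] (B →₀ MvPolynomial σ k)}
    (hf : IsGradedMap dB dC f) (hg : IsGradedMap dA dB g) : IsGradedMap dA dC (f ∘ₗ g) := by
  cases nonempty_fintype B
  intro a c
  rw [LinearMap.comp_apply, linearMap_apply_apply_eq_sum]
  refine IsHomogeneousInt.sum _ _ fun b _ => ?_
  have := (hg a b).mul (hf b c)
  rwa [sub_add_sub_cancel] at this

lemma exists_lift_of_range_le {R A M N : Type*} [CommRing R] [AddCommGroup M] [Module R M]
    [AddCommGroup N] [Module R N] (f : (A →₀ R) →ₗ[R] M) (d : N →ₗ[R] M)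
    (h : LinearMap.range f ≤ LinearMap.range d) : ∃ φ : (A →₀ R) →ₗ[R] N, d ∘ₗ φ = f := by
  have h' : ∀ g : A, ∃ y, d y = f (Finsupp.single g 1) := fun g => h ⟨_, rfl⟩
  choose y hy using h'
  refine ⟨Finsupp.linearCombination R y, ?_⟩
  ext g
  simp [hy]

/-- Freeness gives some lift. Cutting each of its entries down to the degree it should have leaves
the composite with `d` unchanged, since `f` and `d` are graded. -/
lemma exists_graded_lift {A B C : Type*} [Finite B] {dA : A → ℤ} {dB : B → ℤ} {dC : C → ℤ}
    {f : (A →₀ MvPolynomial σ k) →ₗ[MvPolynomial σ k] (C →₀ MvPolynomial σ k)}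
    {d : (B →₀ MvPolynomial σ k) →ₗ[MvPolynomial σ k] (C →₀ MvPolynomial σ k)}
    (hf : IsGradedMap dA dC f) (hd : IsGradedMap dB dC d)
    (h : LinearMap.range f ≤ LinearMap.range d) :
    ∃ φ : (A →₀ MvPolynomial σ k) →ₗ[MvPolynomial σ k] (B →₀ MvPolynomial σ k),
      IsGradedMap dA dB φ ∧ d ∘ₗ φ = f := by
  cases nonempty_fintype B
  have h' : ∀ g : A, ∃ y, d y = f (Finsupp.single g 1) := fun g => h ⟨_, rfl⟩
  choose y hy using h'
  let z : A → (B →₀ MvPolynomial σ k) := fun g =>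
    Finsupp.equivFunOnFinite.symm fun b => componentInt (dA g - dB b) (y g b)
  have hz : ∀ g, d (z g) = f (Finsupp.single g 1) := by
    intro g
    ext1 c
    rw [← (hf g c).componentInt_eq, ← hy, linearMap_apply_apply_eq_sum,
      linearMap_apply_apply_eq_sum d (y g), map_sum]
    refine Finset.sum_congr rfl fun b _ => ?_
    rw [componentInt_mul _ (hd b c)]
    simp [z]
  refine ⟨Finsupp.linearCombination _ z, fun g b => ?_, ?_⟩
  · simpa [z] using isHomogeneousInt_componentInt _ _
  · ext1 g
    ext1
    simp [hz]

lemma constantCoeff_apply_eq_zero {A B : Type*}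
    {f : (A →₀ MvPolynomial σ k) →ₗ[MvPolynomial σ k] (B →₀ MvPolynomial σ k)}
    (hf : ∀ g h, constantCoeff (f (Finsupp.single g 1) h) = 0) (y : A →₀ MvPolynomial σ k)
    (h : B) : constantCoeff (f y h) = 0 := by
  induction y using Finsupp.induction_linear with
  | zero => simp
  | add y z hy hz => simp [hy, hz]
  | single g c =>
    have : Finsupp.single g c = c • Finsupp.single g (1 : MvPolynomial σ k) := by simp
    rw [this, map_smul, Finsupp.smul_apply, smul_eq_mul, map_mul, hf, mul_zero]

lemma constantCoeff_apply_eq_zero_of_forall {A B : Type*} [Finite A]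
    (f : (A →₀ MvPolynomial σ k) →ₗ[MvPolynomial σ k] (B →₀ MvPolynomial σ k))
    {y : A →₀ MvPolynomial σ k} (hy : ∀ g, constantCoeff (y g) = 0) (h : B) :
    constantCoeff (f y h) = 0 := by
  cases nonempty_fintype A
  rw [linearMap_apply_apply_eq_sum, map_sum]
  exact Finset.sum_eq_zero fun g _ => by rw [map_mul, hy, zero_mul]

/-! ### Comparison of resolutions and uniqueness of Betti numbers -/

namespace MinimalGradedFreeResolution

variable {I J Q : Ideal (MvPolynomial σ k)}

instance (F : MinimalGradedFreeResolution I) (i : ℕ) : Finite (F.gens i) := F.finite_gens i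

lemma d_isGradedMap (F : MinimalGradedFreeResolution I) (i : ℕ) :
    IsGradedMap (F.deg (i + 1)) (F.deg i) (F.d i) := F.d_homogeneous i

/-- Multiplication by a homogeneous polynomial `p` of degree `δ` with `p Q ⊆ J` lifts to a graded
chain map of resolutions. -/
theorem exists_comparison (G : MinimalGradedFreeResolution Q) (F : MinimalGradedFreeResolution J)
    {p : MvPolynomial σ k} {δ : ℤ} (hp : IsHomogeneousInt p δ) (hpQ : ∀ f ∈ Q, f * p ∈ J) :
    ∃ φ : ∀ i, (G.gens i →₀ MvPolynomial σ k) →ₗ[MvPolynomial σ k]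
        (F.gens i →₀ MvPolynomial σ k),
      (∀ i, IsGradedMap (fun g => G.deg i g + δ) (F.deg i) (φ i)) ∧
      (∀ y, F.aug (φ 0 y) = G.aug y * p) ∧ ∀ i y, F.d i (φ (i + 1) y) = φ i (G.d i y) := by
  -- The recursion carries, besides gradedness, the fact that boundaries go to boundaries: exactly
  -- what the next lift needs.
  let X : ℕ → Type _ := fun i =>
    {φ : (G.gens i →₀ MvPolynomial σ k) →ₗ[MvPolynomial σ k] (F.gens i →₀ MvPolynomial σ k) //
      IsGradedMap (fun g => G.deg i g + δ) (F.deg i) φ ∧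
      ∀ y, φ (G.d i y) ∈ LinearMap.range (F.d i)}
  have base : ∃ φ : X 0, ∀ y, F.aug (φ.1 y) = G.aug y * p := by
    -- `R` is viewed as a free module of rank one in degree 0, so that the lifting lemma applies to
    -- the augmentations.
    let u : MvPolynomial σ k →ₗ[MvPolynomial σ k] (Unit →₀ MvPolynomial σ k) :=
      Finsupp.lsingle ()
    have hu : Function.Injective u := Finsupp.single_injective ()
    obtain ⟨φ, hφ, hφ'⟩ := exists_graded_lift (dA := fun g => G.deg 0 g + δ) (dB := F.deg 0)
      (dC := fun _ : Unit => 0) (f := u ∘ₗ (p • G.aug)) (d := u ∘ₗ F.aug)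
      (fun g h => by
        have := hp.mul (G.aug_homogeneous g)
        simpa [u, add_comm] using this)
      (fun g h => by simpa [u] using F.aug_homogeneous g)
      (by
        rintro _ ⟨y, rfl⟩
        have hy : G.aug y * p ∈ LinearMap.range F.aug := by
          rw [F.range_aug]
          refine hpQ _ ?_
          have : G.aug y ∈ LinearMap.range G.aug := ⟨y, rfl⟩
          rwa [G.range_aug] at this
        obtain ⟨z, hz⟩ := hy
        exact ⟨z, by simp [hz, mul_comm]⟩)
    have key : ∀ y, F.aug (φ y) = G.aug y * p := fun y => hu (by
      have := LinearMap.congr_fun hφ' y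
      simpa [mul_comm] using this)
    refine ⟨⟨φ, hφ, fun y => ?_⟩, key⟩
    obtain ⟨z, hz⟩ := (F.exact_zero (φ (G.d 0 y))).1 (by
      rw [key, G.exact_zero.apply_apply_eq_zero, zero_mul])
    exact ⟨z, hz⟩
  have step : ∀ i (φ : X i), ∃ ψ : X (i + 1), ∀ y, F.d i (ψ.1 y) = φ.1 (G.d i y) := by
    rintro i ⟨φ, hφ, hr⟩
    obtain ⟨ψ, hψ, hψ'⟩ := exists_graded_lift (dA := fun g => G.deg (i + 1) g + δ)
      (dB := F.deg (i + 1)) (dC := F.deg i) (f := φ ∘ₗ G.d i) (d := F.d i)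
      (hφ.comp (dA := fun g => G.deg (i + 1) g + δ) fun g h => by
        rw [add_sub_add_right_eq_sub]; exact G.d_homogeneous i g h)
      (F.d_homogeneous i)
      (by rintro _ ⟨y, rfl⟩; exact hr y)
    have key : ∀ y, F.d i (ψ y) = φ (G.d i y) := fun y => LinearMap.congr_fun hψ' y
    refine ⟨⟨ψ, hψ, fun y => ?_⟩, key⟩
    obtain ⟨z, hz⟩ := (F.exact_succ i (ψ (G.d (i + 1) y))).1 (by
      rw [key, (G.exact_succ i).apply_apply_eq_zero, map_zero])
    exact ⟨z, hz⟩
  obtain ⟨φ₀, h₀⟩ := base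
  choose next hnext using step
  let φ : ∀ i, X i := fun i => Nat.rec φ₀ next i
  exact ⟨fun i => (φ i).1, fun i => (φ i).2.1, h₀, fun i => hnext i (φ i)⟩

/-- A chain endomorphism of a minimal resolution over the identity is the identity modulo the
variables. -/
theorem constantCoeff_chain_endomorphism (F : MinimalGradedFreeResolution I)
    (θ : ∀ i, (F.gens i →₀ MvPolynomial σ k) →ₗ[MvPolynomial σ k] (F.gens i →₀ MvPolynomial σ k))
    (h₀ : ∀ y, F.aug (θ 0 y) = F.aug y)
    (hθ : ∀ i y, F.d i (θ (i + 1) y) = θ i (F.d i y)) (i : ℕ) (y) (g) :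
    constantCoeff (θ i y g) = constantCoeff (y g) := by
  -- This is the homotopy identity `θ - 1 = d h + h d`, kept only on boundaries, where `h d`
  -- vanishes. Both terms have entries in the ideal of the variables by minimality.
  suffices H : ∀ i, ∃ h : (F.gens i →₀ MvPolynomial σ k) →ₗ[MvPolynomial σ k]
      (F.gens (i + 1) →₀ MvPolynomial σ k),
      (∀ y, θ i (F.d i y) - F.d i y = F.d i (h (F.d i y))) ∧
      ∀ y g, constantCoeff ((θ i y - y) g) = 0 by
    obtain ⟨h, -, hc⟩ := H i
    simpa [sub_eq_zero] using hc y g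
  intro i
  induction i with
  | zero =>
    obtain ⟨h, hh⟩ := exists_lift_of_range_le (θ 0 - LinearMap.id) (F.d 0) (by
      rintro _ ⟨y, rfl⟩
      obtain ⟨z, hz⟩ := (F.exact_zero (θ 0 y - y)).1 (by simp [h₀])
      exact ⟨z, hz⟩)
    have hh' : ∀ y, θ 0 y - y = F.d 0 (h y) := fun y => (LinearMap.congr_fun hh y).symm
    refine ⟨h, fun y => hh' _, fun y g => ?_⟩
    rw [hh']
    exact constantCoeff_apply_eq_zero (F.d_minimal 0) _ _
  | succ i ih =>
    obtain ⟨h, hh, -⟩ := ih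
    obtain ⟨h', hh'⟩ := exists_lift_of_range_le (θ (i + 1) - LinearMap.id - h ∘ₗ F.d i)
      (F.d (i + 1)) (by
        rintro _ ⟨y, rfl⟩
        obtain ⟨z, hz⟩ := (F.exact_succ i (θ (i + 1) y - y - h (F.d i y))).1 (by
          simp [hθ, ← hh])
        exact ⟨z, hz⟩)
    have key : ∀ y, θ (i + 1) y - y = F.d (i + 1) (h' y) + h (F.d i y) := fun y => by
      have := LinearMap.congr_fun hh' y
      simp only [LinearMap.comp_apply, LinearMap.sub_apply, LinearMap.id_apply] at this
      rw [this, sub_add_cancel]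
    refine ⟨h', fun y => ?_, fun y g => ?_⟩
    · rw [key, (F.exact_succ i).apply_apply_eq_zero, map_zero, add_zero]
    · rw [key, Finsupp.add_apply, map_add, constantCoeff_apply_eq_zero (F.d_minimal _),
        constantCoeff_apply_eq_zero_of_forall _
          (constantCoeff_apply_eq_zero (F.d_minimal _) y), add_zero]

/-- The matrix over `k` of the degree `j` part of a map modulo the variables. -/
def residueMatrix {A B : Type*} (dA : A → ℤ) (dB : B → ℤ) (j : ℤ)
    (f : (A →₀ MvPolynomial σ k) →ₗ[MvPolynomial σ k] (B →₀ MvPolynomial σ k)) :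
    Matrix {b // dB b = j} {a // dA a = j} k :=
  fun b a => constantCoeff (f (Finsupp.single a.1 1) b.1)

/-- A graded map has no constant entries between generators of different degrees, so modulo the
variables it is block diagonal and the identity can be read off in degree `j`. -/
lemma residueMatrix_mul_eq_one {A B : Type*} [Fintype A] [DecidableEq A] [Fintype B] {dA : A → ℤ}
    {dB : B → ℤ} (j : ℤ)
    {f : (A →₀ MvPolynomial σ k) →ₗ[MvPolynomial σ k] (B →₀ MvPolynomial σ k)}
    {g : (B →₀ MvPolynomial σ k) →ₗ[MvPolynomial σ k] (A →₀ MvPolynomial σ k)}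
    (hf : IsGradedMap dA dB f)
    (hfg : ∀ y a, constantCoeff (g (f y) a) = constantCoeff (y a)) :
    residueMatrix dB dA j g * residueMatrix dA dB j f = 1 := by
  classical
  ext a a'
  have h := hfg (Finsupp.single a'.1 1) a.1
  rw [linearMap_apply_apply_eq_sum, map_sum] at h
  have h2 : (1 : Matrix {a // dA a = j} {a // dA a = j} k) a a' =
      constantCoeff ((Finsupp.single a'.1 (1 : MvPolynomial σ k)) a.1) := by
    rw [Matrix.one_apply, Finsupp.single_apply]
    by_cases haa : a = a'
    · simp [haa]
    · rw [if_neg haa, if_neg (fun h => haa (Subtype.ext h.symm)), map_zero]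
  rw [h2, ← h, Matrix.mul_apply]
  simp only [residueMatrix, map_mul]
  rw [← Finset.sum_subtype (p := fun b => dB b = j) (Finset.univ.filter fun b => dB b = j)
    (by simp) fun b => constantCoeff (g (Finsupp.single b 1) a.1) *
      constantCoeff (f (Finsupp.single a'.1 1) b), Finset.sum_filter_of_ne]
  · exact Finset.sum_congr rfl fun b _ => mul_comm _ _
  · intro b _ hb
    by_contra hne
    refine right_ne_zero_of_mul hb ((hf a'.1 b).constantCoeff_eq_zero ?_)
    rw [a'.2]
    exact sub_ne_zero.2 (Ne.symm hne)

/-- Comparison maps in both directions compose to the identity modulo the variables; their degree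
`j` blocks are mutually inverse matrices over `k`, hence square. -/
theorem betti_eq (F G : MinimalGradedFreeResolution I) (i : ℕ) (j : ℤ) :
    F.betti i j = G.betti i j := by
  classical
  obtain ⟨φ, hφ, hφ₀, hφd⟩ := exists_comparison F G (p := 1) isHomogeneousInt_one (by simp)
  obtain ⟨ψ, hψ, hψ₀, hψd⟩ := exists_comparison G F (p := 1) isHomogeneousInt_one (by simp)
  simp only [add_zero] at hφ hψ
  have h1 := F.constantCoeff_chain_endomorphism (fun i => ψ i ∘ₗ φ i) (by simp [hψ₀, hφ₀])
    (by simp [hψd, hφd]) i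
  have h2 := G.constantCoeff_chain_endomorphism (fun i => φ i ∘ₗ ψ i) (by simp [hψ₀, hφ₀])
    (by simp [hψd, hφd]) i
  cases nonempty_fintype (F.gens i)
  cases nonempty_fintype (G.gens i)
  rw [betti, betti, Nat.card_eq_fintype_card, Nat.card_eq_fintype_card]
  exact Matrix.square_of_invertible _ _ (residueMatrix_mul_eq_one j (hφ i) h1)
    (residueMatrix_mul_eq_one j (hψ i) h2)

end MinimalGradedFreeResolution

/-! ### Mapping cones -/

section ConeMap

variable {R A A₁ A₂ C C₁ C₂ : Type*} [CommRing R]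

/-- The map `(x, y) ↦ (f x + φ y, - g y)` of free modules. -/
def coneMap (f : (A₁ →₀ R) →ₗ[R] (A →₀ R)) (φ : (C₁ →₀ R) →ₗ[R] (A →₀ R))
    (g : (C₁ →₀ R) →ₗ[R] (C →₀ R)) : (A₁ ⊕ C₁ →₀ R) →ₗ[R] (A ⊕ C →₀ R) :=
  (Finsupp.sumFinsuppLEquivProdFinsupp R).symm.toLinearMap ∘ₗ
    ((f.coprod φ).prod ((0 : (A₁ →₀ R) →ₗ[R] (C →₀ R)).coprod (-g))) ∘ₗ
    (Finsupp.sumFinsuppLEquivProdFinsupp R).toLinearMap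

lemma sumEquiv_coneMap (f : (A₁ →₀ R) →ₗ[R] (A →₀ R)) (φ : (C₁ →₀ R) →ₗ[R] (A →₀ R))
    (g : (C₁ →₀ R) →ₗ[R] (C →₀ R)) (x : A₁ →₀ R) (y : C₁ →₀ R) :
    coneMap f φ g ((Finsupp.sumFinsuppLEquivProdFinsupp R).symm (x, y)) =
      (Finsupp.sumFinsuppLEquivProdFinsupp R).symm (f x + φ y, -g y) := by
  simp [coneMap]

lemma single_inl_eq (a : A) : (Finsupp.single (Sum.inl a) 1 : A ⊕ C →₀ R) =
    (Finsupp.sumFinsuppLEquivProdFinsupp R).symm (Finsupp.single a 1, 0) := by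
  classical
  ext (x | x) <;> simp [Finsupp.single_apply]

lemma single_inr_eq (c : C) : (Finsupp.single (Sum.inr c) 1 : A ⊕ C →₀ R) =
    (Finsupp.sumFinsuppLEquivProdFinsupp R).symm (0, Finsupp.single c 1) := by
  classical
  ext (x | x) <;> simp [Finsupp.single_apply]

lemma exact_coneMap {f₁ : (A₂ →₀ R) →ₗ[R] (A₁ →₀ R)} {f₀ : (A₁ →₀ R) →ₗ[R] (A →₀ R)}
    {g₁ : (C₂ →₀ R) →ₗ[R] (C₁ →₀ R)} {g₀ : (C₁ →₀ R) →ₗ[R] (C →₀ R)}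
    {φ₁ : (C₂ →₀ R) →ₗ[R] (A₁ →₀ R)} {φ₀ : (C₁ →₀ R) →ₗ[R] (A →₀ R)}
    (hf : Function.Exact f₁ f₀) (hg : Function.Exact g₁ g₀)
    (hφ : ∀ y, f₀ (φ₁ y) = φ₀ (g₁ y)) :
    Function.Exact (coneMap f₁ φ₁ g₁) (coneMap f₀ φ₀ g₀) := by
  intro z
  obtain ⟨⟨x, y⟩, rfl⟩ := (Finsupp.sumFinsuppLEquivProdFinsupp R).symm.surjective z
  rw [sumEquiv_coneMap, LinearEquiv.map_eq_zero_iff, Prod.mk_eq_zero, neg_eq_zero]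
  constructor
  · rintro ⟨h1, h2⟩
    obtain ⟨y', rfl⟩ := (hg y).1 h2
    obtain ⟨x', hx'⟩ := (hf (x + φ₁ y')).1 (by rw [map_add, hφ, h1])
    -- The minus sign on `y'` undoes the one in the second component of `coneMap`.
    refine ⟨(Finsupp.sumFinsuppLEquivProdFinsupp R).symm (x', -y'), ?_⟩
    rw [sumEquiv_coneMap, hx']
    simp
  · rintro ⟨w, hw⟩
    obtain ⟨⟨x', y'⟩, rfl⟩ := (Finsupp.sumFinsuppLEquivProdFinsupp R).symm.surjective w
    rw [sumEquiv_coneMap] at hw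
    obtain ⟨rfl, rfl⟩ := Prod.mk.inj ((LinearEquiv.injective _) hw)
    simp [hf.apply_apply_eq_zero, hg.apply_apply_eq_zero, hφ]

end ConeMap

lemma isGradedMap_coneMap {A A₁ C C₁ : Type*} {dA : A → ℤ} {dA₁ : A₁ → ℤ} {dC : C → ℤ}
    {dC₁ : C₁ → ℤ}
    {f : (A₁ →₀ MvPolynomial σ k) →ₗ[MvPolynomial σ k] (A →₀ MvPolynomial σ k)}
    {φ : (C₁ →₀ MvPolynomial σ k) →ₗ[MvPolynomial σ k] (A →₀ MvPolynomial σ k)}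
    {g : (C₁ →₀ MvPolynomial σ k) →ₗ[MvPolynomial σ k] (C →₀ MvPolynomial σ k)}
    (hf : IsGradedMap dA₁ dA f) (hφ : IsGradedMap dC₁ dA φ) (hg : IsGradedMap dC₁ dC g) :
    IsGradedMap (Sum.elim dA₁ dC₁) (Sum.elim dA dC) (coneMap f φ g) := by
  rintro (x | x) (y | y)
  · rw [single_inl_eq, sumEquiv_coneMap]; simpa using hf x y
  · rw [single_inl_eq, sumEquiv_coneMap]; simpa using IsHomogeneousInt.zero _
  · rw [single_inr_eq, sumEquiv_coneMap]; simpa using hφ x y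
  · rw [single_inr_eq, sumEquiv_coneMap]; simpa using (hg x y).neg

lemma constantCoeff_coneMap {A A₁ C C₁ : Type*}
    {f : (A₁ →₀ MvPolynomial σ k) →ₗ[MvPolynomial σ k] (A →₀ MvPolynomial σ k)}
    {φ : (C₁ →₀ MvPolynomial σ k) →ₗ[MvPolynomial σ k] (A →₀ MvPolynomial σ k)}
    {g : (C₁ →₀ MvPolynomial σ k) →ₗ[MvPolynomial σ k] (C →₀ MvPolynomial σ k)}
    (hf : ∀ x y, constantCoeff (f (Finsupp.single x 1) y) = 0)
    (hφ : ∀ x y, constantCoeff (φ (Finsupp.single x 1) y) = 0)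
    (hg : ∀ x y, constantCoeff (g (Finsupp.single x 1) y) = 0) (x y) :
    constantCoeff (coneMap f φ g (Finsupp.single x 1) y) = 0 := by
  rcases x with x | x <;> rcases y with y | y
  · rw [single_inl_eq, sumEquiv_coneMap]; simpa using hf x y
  · rw [single_inl_eq, sumEquiv_coneMap]; simp
  · rw [single_inr_eq, sumEquiv_coneMap]; simpa using hφ x y
  · rw [single_inr_eq, sumEquiv_coneMap]; simpa using hg x y

namespace MinimalGradedFreeResolution

variable {I J Q : Ideal (MvPolynomial σ k)}

/-- Generators of the resolution of `R / Q` obtained from a resolution of `Q`. -/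
def quotGens (G : MinimalGradedFreeResolution Q) : ℕ → Type
  | 0 => Unit
  | i + 1 => G.gens i

/-- Degrees of the generators of the resolution of `(R / Q)(-δ)`. -/
def quotDeg (G : MinimalGradedFreeResolution Q) (δ : ℤ) : ∀ i, G.quotGens i → ℤ
  | 0 => fun _ => δ
  | i + 1 => fun g => G.deg i g + δ

/-- The differentials of the resolution of `R / Q`. -/
def quotD (G : MinimalGradedFreeResolution Q) : ∀ i,
    (G.quotGens (i + 1) →₀ MvPolynomial σ k) →ₗ[MvPolynomial σ k]
      (G.quotGens i →₀ MvPolynomial σ k)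
  | 0 => Finsupp.lsingle () ∘ₗ G.aug
  | i + 1 => G.d i

lemma finite_quotGens (G : MinimalGradedFreeResolution Q) : ∀ i, Finite (G.quotGens i)
  | 0 => inferInstanceAs (Finite Unit)
  | i + 1 => G.finite_gens i

lemma quotD_isGradedMap (G : MinimalGradedFreeResolution Q) (δ : ℤ) : ∀ i,
    IsGradedMap (G.quotDeg δ (i + 1)) (G.quotDeg δ i) (G.quotD i)
  | 0 => fun g _ => by
    change IsHomogeneousInt ((Finsupp.single () (G.aug (Finsupp.single g 1))) ())
      (G.deg 0 g + δ - δ)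
    rw [Finsupp.single_eq_same, add_sub_cancel_right]
    exact G.aug_homogeneous g
  | i + 1 => fun g h => by
    change IsHomogeneousInt (G.d i (Finsupp.single g 1) h) (G.deg (i + 1) g + δ - (G.deg i h + δ))
    rw [add_sub_add_right_eq_sub]
    exact G.d_homogeneous i g h

lemma exact_quotD (G : MinimalGradedFreeResolution Q) : ∀ i,
    Function.Exact (G.quotD (i + 1)) (G.quotD i)
  | 0 => fun y => Iff.trans Finsupp.single_eq_zero (G.exact_zero y)
  | i + 1 => G.exact_succ i

lemma aug_mem (G : MinimalGradedFreeResolution Q) (y) : G.aug y ∈ Q := by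
  have : G.aug y ∈ LinearMap.range G.aug := ⟨y, rfl⟩
  rwa [G.range_aug] at this

/-- The first differential of the resolution of `R / Q` has entries in `Q`, so minimality there
requires `Q` to lie in the ideal of the variables. -/
lemma constantCoeff_quotD (G : MinimalGradedFreeResolution Q)
    (hQ : ∀ f ∈ Q, constantCoeff f = 0) : ∀ i g h,
    constantCoeff (G.quotD i (Finsupp.single g 1) h) = 0
  | 0 => fun g _ => by
    change constantCoeff ((Finsupp.single () (G.aug (Finsupp.single g 1))) ()) = 0
    rw [Finsupp.single_eq_same]
    exact hQ _ (G.aug_mem _)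
  | i + 1 => G.d_minimal i

/-- The augmentation of the mapping cone. -/
def coneAug (F : MinimalGradedFreeResolution J) (p : MvPolynomial σ k) :
    (F.gens 0 ⊕ Unit →₀ MvPolynomial σ k) →ₗ[MvPolynomial σ k] MvPolynomial σ k :=
  (F.aug.coprod (LinearMap.toSpanSingleton _ _ p ∘ₗ Finsupp.lapply ())) ∘ₗ
    (Finsupp.sumFinsuppLEquivProdFinsupp (MvPolynomial σ k)).toLinearMap

lemma coneAug_symm (F : MinimalGradedFreeResolution J) (p : MvPolynomial σ k) (x)
    (y : Unit →₀ MvPolynomial σ k) :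
    coneAug F p ((Finsupp.sumFinsuppLEquivProdFinsupp (MvPolynomial σ k)).symm (x, y)) =
      F.aug x + y () * p := by
  simp [coneAug]

lemma range_coneAug (F : MinimalGradedFreeResolution J) (p : MvPolynomial σ k) :
    LinearMap.range (coneAug F p) = J ⊔ Ideal.span {p} := by
  ext f
  rw [Submodule.mem_sup]
  constructor
  · rintro ⟨z, rfl⟩
    obtain ⟨⟨x, y⟩, rfl⟩ :=
      (Finsupp.sumFinsuppLEquivProdFinsupp (MvPolynomial σ k)).symm.surjective z
    exact ⟨_, F.aug_mem x, _, Ideal.mem_span_singleton'.2 ⟨_, rfl⟩, (coneAug_symm F p x y).symm⟩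
  · rintro ⟨f₁, h₁, f₂, h₂, rfl⟩
    obtain ⟨r, rfl⟩ := Ideal.mem_span_singleton'.1 h₂
    have h₁' : f₁ ∈ LinearMap.range F.aug := F.range_aug.symm ▸ h₁
    obtain ⟨x, rfl⟩ := h₁'
    exact ⟨(Finsupp.sumFinsuppLEquivProdFinsupp (MvPolynomial σ k)).symm
      (x, Finsupp.single () r), by rw [coneAug_symm, Finsupp.single_eq_same]⟩

/-- A relation `F.aug x + r p = 0` says that `r` lies in `J : p = Q`, the image of `G.aug`; after
lifting `r`, what remains is a cycle of `F`. -/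
lemma exact_coneAug (F : MinimalGradedFreeResolution J) (G : MinimalGradedFreeResolution Q)
    {p : MvPolynomial σ k} (hp : ∀ f, f * p ∈ J ↔ f ∈ Q)
    {φ : (G.gens 0 →₀ MvPolynomial σ k) →ₗ[MvPolynomial σ k] (F.gens 0 →₀ MvPolynomial σ k)}
    (hφ : ∀ y, F.aug (φ y) = G.aug y * p) :
    Function.Exact (coneMap (F.d 0) φ (Finsupp.lsingle () ∘ₗ G.aug)) (coneAug F p) := by
  intro z
  obtain ⟨⟨x, y⟩, rfl⟩ :=
    (Finsupp.sumFinsuppLEquivProdFinsupp (MvPolynomial σ k)).symm.surjective z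
  rw [coneAug_symm]
  constructor
  · intro h
    have hy : y () ∈ LinearMap.range G.aug := by
      rw [G.range_aug, ← hp, eq_neg_of_add_eq_zero_right h]
      exact J.neg_mem (F.aug_mem x)
    obtain ⟨w, hw⟩ := hy
    obtain ⟨x', hx'⟩ := (F.exact_zero (x + φ w)).1 (by rw [map_add, hφ, hw, h])
    refine ⟨(Finsupp.sumFinsuppLEquivProdFinsupp (MvPolynomial σ k)).symm (x', -w), ?_⟩
    rw [sumEquiv_coneMap]
    congr 2
    · rw [hx', map_neg, add_neg_cancel_right]
    · rw [map_neg, neg_neg]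
      refine Finsupp.ext fun u => ?_
      simpa using hw
  · rintro ⟨w, hw⟩
    obtain ⟨⟨x', y'⟩, rfl⟩ :=
      (Finsupp.sumFinsuppLEquivProdFinsupp (MvPolynomial σ k)).symm.surjective w
    rw [sumEquiv_coneMap] at hw
    obtain ⟨rfl, rfl⟩ := Prod.mk.inj ((LinearEquiv.injective _) hw)
    have h1 : F.aug (F.d 0 x') = 0 := F.exact_zero.apply_apply_eq_zero x'
    rw [map_add, h1, hφ]
    simp

lemma coneAug_homogeneous (F : MinimalGradedFreeResolution J) {p : MvPolynomial σ k} {δ : ℤ}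
    (hp : IsHomogeneousInt p δ) : ∀ g, IsHomogeneousInt (coneAug F p (Finsupp.single g 1))
      (Sum.elim (F.deg 0) (fun _ => δ) g)
  | Sum.inl g => by
    rw [single_inl_eq, coneAug_symm]
    simpa using F.aug_homogeneous g
  | Sum.inr g => by
    rw [single_inr_eq, coneAug_symm]
    simpa using hp

/-- The mapping cone resolution of `J + (p)`, where `Q = J : p`. -/
def cone (F : MinimalGradedFreeResolution J) (G : MinimalGradedFreeResolution Q)
    {p : MvPolynomial σ k} {δ : ℤ} (hp : IsHomogeneousInt p δ) (hQ : ∀ f, f * p ∈ J ↔ f ∈ Q)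
    (hQ₀ : ∀ f ∈ Q, constantCoeff f = 0)
    (φ : ∀ i, (G.gens i →₀ MvPolynomial σ k) →ₗ[MvPolynomial σ k] (F.gens i →₀ MvPolynomial σ k))
    (hφ : ∀ i, IsGradedMap (fun g => G.deg i g + δ) (F.deg i) (φ i))
    (hφ₀ : ∀ y, F.aug (φ 0 y) = G.aug y * p)
    (hφd : ∀ i y, F.d i (φ (i + 1) y) = φ i (G.d i y))
    (hdeg : ∀ i g h, F.deg i h < G.deg i g + δ) :
    MinimalGradedFreeResolution (J ⊔ Ideal.span {p}) where
  gens i := F.gens i ⊕ G.quotGens i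
  finite_gens i := by
    have := G.finite_quotGens i
    infer_instance
  deg i := Sum.elim (F.deg i) (G.quotDeg δ i)
  aug := coneAug F p
  d i := coneMap (F.d i) (φ i) (G.quotD i)
  range_aug := range_coneAug F p
  exact_zero := exact_coneAug F G hQ hφ₀
  exact_succ i := by
    refine exact_coneMap (F.exact_succ i) (G.exact_quotD i) ?_
    intro y
    exact hφd i y
  aug_homogeneous g := coneAug_homogeneous F hp g
  d_homogeneous i := isGradedMap_coneMap (F.d_isGradedMap i) (hφ i) (G.quotD_isGradedMap δ i)
  d_minimal i := constantCoeff_coneMap (F.d_minimal i)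
    -- The entries of the comparison map have positive degree by `hdeg`, so they have no constant
    -- term.
    (fun g h => (hφ i g h).constantCoeff_eq_zero (sub_pos.2 (hdeg i g h)).ne')
    (G.constantCoeff_quotD hQ₀ i)

end MinimalGradedFreeResolution

/-- `I` has a minimal graded free resolution with graded Betti numbers `b`. -/
def HasBetti (I : Ideal (MvPolynomial σ k)) (b : ℕ → ℤ → ℕ) : Prop :=
  ∃ F : MinimalGradedFreeResolution I, ∀ i j, F.betti i j = b i j

lemma HasBetti.gradedBetti_eq {I : Ideal (MvPolynomial σ k)} {b : ℕ → ℤ → ℕ} (h : HasBetti I b)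
    (i : ℕ) (j : ℤ) : gradedBetti I i j = b i j := by
  obtain ⟨F, hF⟩ := h
  rw [gradedBetti, dif_pos ⟨F⟩, ← hF]
  exact MinimalGradedFreeResolution.betti_eq _ _ _ _

/-- Betti numbers of `(R / Q)(-δ)` in terms of the Betti numbers `c` of the ideal `Q`. -/
def quotBetti (δ : ℤ) (c : ℕ → ℤ → ℕ) : ℕ → ℤ → ℕ
  | 0, j => if j = δ then 1 else 0
  | i + 1, j => c i (j - δ)

/-- The Betti numbers add because the degree hypothesis makes the mapping cone minimal, so nothing
cancels. -/
theorem HasBetti.sup_span_singleton {J Q : Ideal (MvPolynomial σ k)} {b c : ℕ → ℤ → ℕ}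
    (hJ : HasBetti J b) (hQ : HasBetti Q c) {p : MvPolynomial σ k} {δ : ℤ}
    (hp : IsHomogeneousInt p δ) (hpQ : ∀ f, f * p ∈ J ↔ f ∈ Q)
    (hQ₀ : ∀ f ∈ Q, constantCoeff f = 0)
    (hdeg : ∀ i j j', b i j ≠ 0 → c i j' ≠ 0 → j < j' + δ) :
    HasBetti (J ⊔ Ideal.span {p}) fun i j => b i j + quotBetti δ c i j := by
  obtain ⟨F, hF⟩ := hJ
  obtain ⟨G, hG⟩ := hQ
  obtain ⟨φ, hφ, hφ₀, hφd⟩ := G.exists_comparison F hp fun f hf => (hpQ f).2 hf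
  refine ⟨F.cone G hp hpQ hQ₀ φ hφ hφ₀ hφd fun i g h => hdeg i _ _ ?_ ?_, fun i j => ?_⟩
  · rw [← hF]
    have : Nonempty {g // F.deg i g = F.deg i h} := ⟨⟨h, rfl⟩⟩
    exact Nat.card_pos.ne'
  · rw [← hG]
    have : Nonempty {h // G.deg i h = G.deg i g} := ⟨⟨g, rfl⟩⟩
    exact Nat.card_pos.ne'
  · have := G.finite_quotGens i
    change Nat.card {g : F.gens i ⊕ G.quotGens i // Sum.elim (F.deg i) (G.quotDeg δ i) g = j} =
      b i j + quotBetti δ c i j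
    rw [Nat.card_congr (Equiv.subtypeSum (p := fun g => Sum.elim (F.deg i) (G.quotDeg δ i) g = j)),
      Nat.card_sum, ← hF]
    refine congrArg₂ (· + ·) rfl ?_
    rcases i with _ | i
    · change Nat.card {u : Unit // δ = j} = if j = δ then 1 else 0
      split_ifs with h
      · subst h; simp
      · have : IsEmpty {u : Unit // δ = j} := ⟨fun u => h u.2.symm⟩
        simp
    · change _ = c i (j - δ)
      rw [← hG]
      exact Nat.card_congr (Equiv.subtypeEquivRight fun g =>
        (by rw [eq_sub_iff_add_eq]; rfl))

lemma hasBetti_bot : HasBetti (⊥ : Ideal (MvPolynomial σ k)) fun _ _ => 0 := by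
  refine ⟨{ gens := fun _ => Empty, finite_gens := fun _ => inferInstance, deg := fun _ => nofun
            aug := 0, d := fun _ => 0, range_aug := by simp
            exact_zero := fun y => by simp [Subsingleton.elim y 0]
            exact_succ := fun _ y => by simp [Subsingleton.elim y 0]
            aug_homogeneous := nofun, d_homogeneous := fun _ => nofun
            d_minimal := fun _ => nofun }, fun i j => ?_⟩
  have : IsEmpty {g : Empty // (nofun : Empty → ℤ) g = j} := ⟨fun g => g.1.elim⟩
  exact Nat.card_of_isEmpty

/-! ### Ideals generated by variables -/

lemma constantCoeff_eq_zero_of_mem_span_X {q : Set σ} {f : MvPolynomial σ k}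
    (hf : f ∈ Ideal.span (X '' q)) : constantCoeff f = 0 := by
  by_contra h
  obtain ⟨v, -, hv⟩ := mem_ideal_span_X_image.1 hf 0 (mem_support_iff.2 (by rwa [← constantCoeff_eq]))
  exact hv rfl

lemma mul_monomial_mem_iff {P : (σ →₀ ℕ) → Prop} (f : MvPolynomial σ k) (t : σ →₀ ℕ) :
    (∀ s ∈ (f * monomial t 1).support, P s) ↔ ∀ s ∈ f.support, P (s + t) := by
  classical
  constructor
  · intro h s hs
    refine h _ ?_
    rw [mem_support_iff, coeff_mul_monomial, mul_one]
    exact mem_support_iff.1 hs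
  · intro h s hs
    rw [mem_support_iff, coeff_mul_monomial'] at hs
    split_ifs at hs with hle
    · have := h (s - t) (mem_support_iff.2 (by simpa using hs))
      rwa [tsub_add_cancel_of_le hle] at this
    · exact absurd rfl hs

/-- Koszul resolution, built one variable at a time: a new variable is a nonzerodivisor modulo the
previous ones, so the colon ideal is the old ideal itself and the ranks satisfy Pascal's rule. The
index is shifted by one because the ideal, not its quotient, is resolved. -/
theorem hasBetti_span_X [DecidableEq σ] (q : Finset σ) :
    HasBetti (Ideal.span (X '' (q : Set σ)) : Ideal (MvPolynomial σ k))
      fun i j => if j = i + 1 then q.card.choose (i + 1) else 0 := by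
  induction q using Finset.induction_on with
  | empty => simpa using hasBetti_bot
  | insert v q hv ih =>
    have h := ih.sup_span_singleton ih (p := X v) (isHomogeneousInt_X v) ?_
      (fun f hf => constantCoeff_eq_zero_of_mem_span_X hf) ?_
    · have e : (Ideal.span (X '' ((insert v q : Finset σ) : Set σ)) : Ideal (MvPolynomial σ k)) =
          Ideal.span (X '' (q : Set σ)) ⊔ Ideal.span {X v} := by
        rw [Finset.coe_insert, Set.image_insert_eq, Ideal.span_insert, sup_comm]
      rw [e]
      convert h using 3 with i j
      rw [Finset.card_insert_of_notMem hv]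
      rcases i with _ | i
      · simp only [quotBetti]
        split_ifs <;> simp_all
      · simp only [quotBetti]
        by_cases hj : j = ((i + 1 : ℕ) : ℤ) + 1
        · rw [if_pos hj, if_pos hj, if_pos (by push_cast at hj; omega), Nat.choose_succ_succ,
            add_comm]
        · rw [if_neg hj, if_neg hj, if_neg (by push_cast at hj; omega)]
    · intro f
      rw [mem_ideal_span_X_image, mem_ideal_span_X_image, X, mul_monomial_mem_iff]
      refine forall₂_congr fun s _ => exists_congr fun w => and_congr_right fun hw => ?_
      have : v ≠ w := fun h => hv (h ▸ hw)
      simp [this]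
    · intro i j j' hj hj'
      have h1 : j = i + 1 := by by_contra h; exact hj (if_neg h)
      have h2 : j' = i + 1 := by by_contra h; exact hj' (if_neg h)
      omega

/-- One step of a filtration with linear quotients. -/
theorem HasBetti.sup_monomial [DecidableEq σ] {S : Set (σ →₀ ℕ)} {b : ℕ → ℤ → ℕ}
    (hS : HasBetti (Ideal.span ((fun m => monomial m (1 : k)) '' S)) b) (t : σ →₀ ℕ) (q : Finset σ)
    (hq : ∀ s : σ →₀ ℕ, (∃ t' ∈ S, t' ≤ s + t) ↔ ∃ v ∈ q, s v ≠ 0)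
    (hb : ∀ i j, b i j ≠ 0 → j ≤ t.degree + i) :
    HasBetti (Ideal.span ((fun m => monomial m (1 : k)) '' insert t S)) fun i j =>
      b i j + if j = t.degree + i then q.card.choose i else 0 := by
  have h := hS.sup_span_singleton (hasBetti_span_X q) (isHomogeneousInt_monomial t 1) ?_
    (fun f hf => constantCoeff_eq_zero_of_mem_span_X hf) ?_
  · rw [Set.image_insert_eq, Ideal.span_insert, sup_comm]
    convert h using 4 with i j
    rcases i with _ | i
    · simp [quotBetti]
    · simp only [quotBetti]
      by_cases hj : j = (t.degree : ℤ) + ((i + 1 : ℕ) : ℤ)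
      · rw [if_pos hj, if_pos (by push_cast at hj; omega)]
      · rw [if_neg hj, if_neg (by push_cast at hj; omega)]
  · intro f
    rw [mem_ideal_span_monomial_image, mul_monomial_mem_iff, mem_ideal_span_X_image]
    exact forall₂_congr fun s _ => hq s
  · intro i j j' hj hj'
    have h1 := hb i j hj
    have h2 : j' = i + 1 := by by_contra h; exact hj' (if_neg h)
    omega

/-! ### Words and exponent vectors -/

section Words

variable {n : ℕ}

/-- The exponent vector of the product of the variables in a word. -/
def wordExp (w : List (Fin n)) : Fin n →₀ ℕ := (w.map fun x => Finsupp.single x 1).sum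

lemma wordExp_cons (x : Fin n) (w : List (Fin n)) :
    wordExp (x :: w) = Finsupp.single x 1 + wordExp w := by simp [wordExp]

lemma wordExp_append (w w' : List (Fin n)) : wordExp (w ++ w') = wordExp w + wordExp w' := by
  simp [wordExp]

lemma toMultiset_wordExp (w : List (Fin n)) : Finsupp.toMultiset (wordExp w) = w := by
  induction w with
  | nil => simp [wordExp]
  | cons x w ih => rw [wordExp_cons, map_add, ih]; simp

lemma sortedVars_pairwise (m : Fin n →₀ ℕ) : (sortedVars m).Pairwise (· ≤ ·) :=
  Multiset.pairwise_sort _ _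

lemma wordExp_sortedVars (m : Fin n →₀ ℕ) : wordExp (sortedVars m) = m := by
  classical
  apply Multiset.toFinsupp.symm.injective
  change Finsupp.toMultiset _ = Finsupp.toMultiset _
  rw [toMultiset_wordExp, sortedVars, Multiset.sort_eq]

lemma sortedVars_injective : Function.Injective (sortedVars (n := n)) :=
  Function.LeftInverse.injective wordExp_sortedVars

lemma sortedVars_wordExp {w : List (Fin n)} (hw : w.Pairwise (· ≤ ·)) :
    sortedVars (wordExp w) = w := by
  refine List.Perm.eq_of_pairwise (fun a b _ _ => le_antisymm) (sortedVars_pairwise _) hw ?_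
  rw [← Multiset.coe_eq_coe, sortedVars, Multiset.sort_eq, toMultiset_wordExp]

lemma wordExp_apply_ne_zero {w : List (Fin n)} {x : Fin n} : wordExp w x ≠ 0 ↔ x ∈ w := by
  rw [← Finsupp.mem_support_iff, ← Finsupp.mem_toMultiset, toMultiset_wordExp, Multiset.mem_coe]

/-- The `p`-th letter of a word, as a natural number (and `0` past the end). -/
def letter (w : List (Fin n)) (p : ℕ) : ℕ := (w.map Fin.val).getD p 0

lemma letter_eq {w : List (Fin n)} {p : ℕ} (hp : p < w.length) : letter w p = (w[p] : ℕ) := by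
  simp [letter, hp]

lemma letter_mono {w : List (Fin n)} (hw : w.Pairwise (· ≤ ·)) {p r : ℕ} (hpr : p ≤ r)
    (hr : r < w.length) : letter w p ≤ letter w r := by
  rcases hpr.eq_or_lt with rfl | hlt
  · rfl
  · rw [letter_eq hr, letter_eq (hlt.trans hr)]
    exact List.pairwise_iff_getElem.1 hw _ _ _ _ hlt

/-- The exponent of `x_v` in the shifted word. -/
def shiftCount (a : ℕ → ℕ) (w : List (Fin n)) (v : ℕ) : ℕ :=
  ((Finset.range w.length).filter fun p => letter w p + a p = v).card

lemma shiftExp_apply (a : ℕ → ℕ) (m : Fin n →₀ ℕ) (v : ℕ) :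
    shiftExp a m v = shiftCount a (sortedVars m) v := by
  rw [shiftExp, shiftCount, Finset.card_filter, Finset.sum_range, Finsupp.finsetSum_apply]
  refine Finset.sum_congr rfl fun p _ => ?_
  rw [Finsupp.single_apply, letter_eq p.2]
  rfl

lemma letter_add_mem_support (a : ℕ → ℕ) (m : Fin n →₀ ℕ) {p : ℕ}
    (hp : p < (sortedVars m).length) :
    letter (sortedVars m) p + a p ∈ (shiftExp a m).support := by
  rw [Finsupp.mem_support_iff, shiftExp_apply]
  refine (Finset.card_pos.2 ⟨p, ?_⟩).ne'
  exact Finset.mem_filter.2 ⟨Finset.mem_range.2 hp, rfl⟩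

lemma length_sortedVars (m : Fin n →₀ ℕ) : (sortedVars m).length = m.degree := by
  rw [sortedVars, Multiset.length_sort, Finsupp.card_toMultiset, Finsupp.degree_eq_sum,
    Finsupp.sum_fintype _ _ (fun _ => rfl)]
  rfl

lemma degree_shiftExp (a : ℕ → ℕ) (m : Fin n →₀ ℕ) : (shiftExp a m).degree = m.degree := by
  rw [shiftExp, map_sum, ← length_sortedVars]
  simp

/-- The value of the last letter of a word (and `0` for the empty word). -/
def lastLetter (w : List (Fin n)) : ℕ := letter w (w.length - 1)

/-- The variables generating the colon ideal at the generator with the given word. -/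
def colonVars (a : ℕ → ℕ) (w : List (Fin n)) : Finset ℕ :=
  (Finset.range (lastLetter w)).image fun j =>
    j + a ((Finset.range w.length).filter fun p => letter w p ≤ j).card

/-- For monotone `a` the indexing map is strictly increasing in `j`. This is where the dependence on
`a` disappears. -/
lemma card_colonVars {a : ℕ → ℕ} (ha : Monotone a) (w : List (Fin n)) :
    (colonVars a w).card = lastLetter w := by
  rw [colonVars, Finset.card_image_of_injective, Finset.card_range]
  refine StrictMono.injective fun j j' h => add_lt_add_of_lt_of_le h (ha ?_)
  exact Finset.card_le_card (Finset.monotone_filter_right _ fun p _ hp => hp.trans h.le)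

lemma card_filter_letter_le {w : List (Fin n)} (hw : w.Pairwise (· ≤ ·)) {l j : ℕ}
    (hl : l < w.length) (hj : j < letter w l) (hlt : ∀ p < l, letter w p ≤ j) :
    ((Finset.range w.length).filter fun p => letter w p ≤ j).card = l := by
  have : ((Finset.range w.length).filter fun p => letter w p ≤ j) = Finset.range l := by
    ext p
    rw [Finset.mem_filter, Finset.mem_range, Finset.mem_range]
    constructor
    · rintro ⟨hp, hpj⟩
      by_contra h
      have := letter_mono hw (not_lt.1 h) hp
      omega
    · exact fun hp => ⟨hp.trans hl, hlt p hp⟩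
  rw [this, Finset.card_range]

/-- The number of letters `≤ j` in a sorted word is the first position `l` whose letter exceeds `j`.
So these variables correspond to the ways of lowering the letter at `l` to `j` while keeping the
word sorted. -/
lemma mem_colonVars {a : ℕ → ℕ} {w : List (Fin n)} (hw : w.Pairwise (· ≤ ·)) {v : ℕ} :
    v ∈ colonVars a w ↔ ∃ l j, l < w.length ∧ j < letter w l ∧ (∀ p < l, letter w p ≤ j) ∧
      v = j + a l := by
  rw [colonVars, Finset.mem_image]
  constructor
  · rintro ⟨j, hj, rfl⟩
    rw [Finset.mem_range, lastLetter] at hj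
    have hex : ∃ l, j < letter w l := ⟨_, hj⟩
    have hlen : Nat.find hex < w.length := by
      refine (Nat.find_min' hex hj).trans_lt (Nat.sub_lt ?_ one_pos)
      -- The empty word is excluded because its default last letter is 0, and nothing lies below 0.
      rcases w with _ | ⟨x, w⟩
      · simp [letter] at hj
      · simp
    have hlt : ∀ p < Nat.find hex, letter w p ≤ j := fun p hp => not_lt.1 (Nat.find_min hex hp)
    refine ⟨Nat.find hex, j, hlen, Nat.find_spec hex, hlt, ?_⟩
    rw [card_filter_letter_le hw hlen (Nat.find_spec hex) hlt]
  · rintro ⟨l, j, hl, hj, hlt, rfl⟩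
    refine ⟨j, Finset.mem_range.2 (hj.trans_le (letter_mono hw (by omega) (by omega))), ?_⟩
    rw [card_filter_letter_le hw hl hj hlt]

/-- If `w'` drops below `w` for the first time at position `l`, then the shift of `w'` is
divisible by a higher power of the variable at position `l` than the shift of `w`, and that
variable is one of `colonVars`. -/
lemma shiftCount_lt_of_first_drop {a : ℕ → ℕ} (ha : Monotone a) {w w' : List (Fin n)}
    (hw : w.Pairwise (· ≤ ·)) (hw' : w'.Pairwise (· ≤ ·)) {l : ℕ} (hl : l < w.length)
    (hl' : l < w'.length) (hlt : letter w' l < letter w l)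
    (hmin : ∀ p < l, letter w p ≤ letter w' p) :
    letter w' l + a l ∈ colonVars a w ∧
      shiftCount a w (letter w' l + a l) < shiftCount a w' (letter w' l + a l) := by
  have hmin' : ∀ p < l, letter w p ≤ letter w' l := fun p hp =>
    (hmin p hp).trans (letter_mono hw' hp.le hl')
  refine ⟨(mem_colonVars hw).2 ⟨l, _, hl, hlt, hmin', rfl⟩, ?_⟩
  refine Finset.card_lt_card (Finset.ssubset_iff_subset_ne.2 ⟨fun p hp => ?_, fun h => ?_⟩)
  -- A position of `w` contributing to this variable lies before `l`, since from `l` on the shifted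
  -- letters are too large. There `w p ≤ w' p ≤ w' l` and `a p ≤ a l` must all be equalities, so
  -- `w'` contributes as well; position `l` contributes for `w'` only.
  · rw [Finset.mem_filter, Finset.mem_range] at hp ⊢
    have hpl : p < l := by
      by_contra h
      have h1 := letter_mono hw (not_lt.1 h) hp.1
      have h2 := ha (not_lt.1 h)
      omega
    have h1 := hmin p hpl
    have h2 := letter_mono hw' hpl.le hl'
    have h3 := ha hpl.le
    omega
  · have : l ∈ (Finset.range w'.length).filter fun p => letter w' p + a p = letter w' l + a l :=
      Finset.mem_filter.2 ⟨Finset.mem_range.2 hl', rfl⟩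
    rw [← h, Finset.mem_filter] at this
    omega

lemma letter_take {w : List (Fin n)} {r p : ℕ} (hp : p < (w.take r).length) :
    letter (w.take r) p = letter w p := by
  have hp' : p < w.length := by rw [List.length_take] at hp; omega
  rw [letter_eq hp, letter_eq hp', List.getElem_take]

lemma shiftCount_take_le (a : ℕ → ℕ) (w : List (Fin n)) (r v : ℕ) :
    shiftCount a (w.take r) v ≤ shiftCount a w v := by
  refine Finset.card_le_card fun p hp => ?_
  rw [Finset.mem_filter, Finset.mem_range] at hp ⊢
  rw [letter_take hp.1] at hp
  have := hp.1
  rw [List.length_take] at this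
  exact ⟨by omega, hp.2⟩

lemma letter_set {w : List (Fin n)} {l : ℕ} (hl : l < w.length) (x : Fin n) (p : ℕ) :
    letter (w.set l x) p = if p = l then (x : ℕ) else letter w p := by
  by_cases hp : p < w.length
  · rw [letter_eq (by simpa using hp), letter_eq hp, List.getElem_set]
    simp only [eq_comm (a := p)]
    split_ifs <;> rfl
  · have : p ≠ l := by omega
    simp [letter, hp, this]

lemma shiftCount_set_le (a : ℕ → ℕ) {w : List (Fin n)} {l : ℕ} (hl : l < w.length) (x : Fin n)
    (v : ℕ) : shiftCount a (w.set l x) v ≤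
      shiftCount a w v + if v = x + a l then 1 else 0 := by
  have hsub : ((Finset.range (w.set l x).length).filter fun p =>
      letter (w.set l x) p + a p = v) ⊆
      ((Finset.range w.length).filter fun p => letter w p + a p = v) ∪
        (if v = x + a l then {l} else ∅) := by
    intro p hp
    rw [Finset.mem_filter, letter_set hl, List.length_set] at hp
    rw [Finset.mem_union, Finset.mem_filter]
    by_cases hpl : p = l
    · right
      subst hpl
      rw [if_pos rfl] at hp
      rw [if_pos hp.2.symm, Finset.mem_singleton]
    · left
      rwa [if_neg hpl] at hp
  refine (Finset.card_le_card hsub).trans ((Finset.card_union_le _ _).trans ?_)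
  refine add_le_add le_rfl ?_
  split_ifs <;> simp

lemma pairwise_set {w : List (Fin n)} (hw : w.Pairwise (· ≤ ·)) {l : ℕ} (hl : l < w.length)
    {x : Fin n} (hx : (x : ℕ) < letter w l) (hlt : ∀ p < l, letter w p ≤ x) :
    (w.set l x).Pairwise (· ≤ ·) := by
  rw [List.pairwise_iff_getElem]
  intro p r hp hr hpr
  rw [Fin.le_def, ← letter_eq hp, ← letter_eq hr, letter_set hl, letter_set hl]
  rw [List.length_set] at hp hr
  have h1 := letter_mono hw hpr.le hr
  split_ifs with h2 h3 h3
  · rfl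
  · subst h2; omega
  · subst h3; exact hlt p hpr
  · exact h1

end Words

/-! ### Borel fixed ideals -/

section Borel

variable {n : ℕ} {I : Ideal (MvPolynomial (Fin n) k)}

lemma monomial_mem_of_le {I : Ideal (MvPolynomial σ k)} {s t : σ →₀ ℕ} (h : s ≤ t)
    (hs : monomial s (1 : k) ∈ I) : monomial t (1 : k) ∈ I := by
  have : monomial t (1 : k) = monomial (t - s) 1 * monomial s 1 := by
    rw [monomial_mul, tsub_add_cancel_of_le h, one_mul]
  rw [this]
  exact I.mul_mem_left _ hs

lemma IsBorelFixed.monomial_mem_of_le_letter (hI : IsBorelFixed I) {x y : Fin n} (hxy : x ≤ y)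
    (c : Fin n →₀ ℕ) (h : monomial (c + Finsupp.single y 1) (1 : k) ∈ I) :
    monomial (c + Finsupp.single x 1) (1 : k) ∈ I := by
  rcases hxy.eq_or_lt with rfl | hlt
  · exact h
  · have := hI.2 _ h y x (by simp) hlt
    rwa [add_tsub_cancel_right] at this

lemma IsBorelFixed.monomial_mem_of_forall₂ (hI : IsBorelFixed I) {w w' : List (Fin n)}
    (h : List.Forall₂ (· ≤ ·) w w') (hw' : monomial (wordExp w') (1 : k) ∈ I) :
    monomial (wordExp w) (1 : k) ∈ I := by
  -- The cofactor `c` collects the letters already lowered, so that the induction changes one letter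
  -- at a time.
  suffices H : ∀ c, monomial (c + wordExp w') (1 : k) ∈ I → monomial (c + wordExp w) (1 : k) ∈ I by
    simpa using H 0 (by simpa using hw')
  clear hw'
  induction h with
  | nil => exact fun c hc => hc
  | @cons x y w w' hxy _ ih =>
    intro c hc
    rw [wordExp_cons, ← add_assoc] at hc ⊢
    refine ih _ ?_
    rw [add_right_comm] at hc ⊢
    exact hI.monomial_mem_of_le_letter hxy _ hc

/-- Every monomial of a Borel fixed ideal has an initial subword that is a minimal generator. -/
lemma IsBorelFixed.exists_take_mem_minGens (hI : IsBorelFixed I) {w : List (Fin n)}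
    (hw : w.Pairwise (· ≤ ·)) (hwI : monomial (wordExp w) (1 : k) ∈ I) :
    ∃ r ≤ w.length, wordExp (w.take r) ∈ minGens I := by
  classical
  have hex : ∃ r, monomial (wordExp (w.take r)) (1 : k) ∈ I := ⟨w.length, by simpa using hwI⟩
  have hr := Nat.find_spec hex
  have hmin : ∀ r' < Nat.find hex, monomial (wordExp (w.take r')) (1 : k) ∉ I :=
    fun r' h => Nat.find_min hex h
  have hle : Nat.find hex ≤ w.length := Nat.find_le (by simpa using hwI)
  -- The shortest prefix in `I` is the desired generator: a proper divisor `y` in `I` would force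
  -- the prefix without its last letter `x` into `I`.
  generalize Nat.find hex = r at hr hmin hle
  refine ⟨r, hle, hr, fun y hy hyle => ?_⟩
  by_contra hne
  obtain ⟨i, hi⟩ : ∃ i, y i < wordExp (w.take r) i := by
    by_contra! h
    exact hne h
  obtain ⟨r, rfl⟩ : ∃ r', r = r' + 1 := by
    rcases r with _ | r
    · simp [wordExp] at hi
    · exact ⟨r, rfl⟩
  have hsplit : w.take (r + 1) = w.take r ++ [w[r]] := by simp
  set p := w.take r with hp
  set x := w[r] with hx
  have hEx : wordExp (w.take (r + 1)) = wordExp p + Finsupp.single x 1 := by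
    rw [hsplit, wordExp_append]; simp [wordExp]
  have hmem : i ∈ p ++ [x] := by
    rw [← hsplit, ← wordExp_apply_ne_zero]; omega
  have hix : i ≤ x := by
    have hpw : (p ++ [x]).Pairwise (· ≤ ·) := hsplit ▸ hw.sublist (List.take_sublist _ _)
    rcases List.mem_append.1 hmem with h | h
    · exact (List.pairwise_append.1 hpw).2.2 i h x (by simp)
    · rw [List.mem_singleton.1 h]
  refine hmin r (Nat.lt_succ_self r) ?_
  rw [← hp]
  rw [hEx] at hyle hi
  by_cases hxi : i = x
  · subst hxi
    refine monomial_mem_of_le (fun v => ?_) hy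
    have := hyle v
    rw [Finsupp.add_apply, Finsupp.single_apply] at this hi
    rw [if_pos rfl] at hi
    split_ifs at this with h
    · subst h; omega
    · omega
  · have hip : i ∈ p := by
      rcases List.mem_append.1 hmem with h | h
      · exact h
      · exact absurd (List.mem_singleton.1 h) hxi
    have hpi : Finsupp.single i 1 ≤ wordExp p := by
      rw [Finsupp.single_le_iff]
      exact Nat.one_le_iff_ne_zero.2 (wordExp_apply_ne_zero.2 hip)
    -- Here `y` divides `p x_x / x_i` with `i < x`; the Borel move from `x` to `i` then puts `p`
    -- itself in `I`.
    have h1 : monomial (wordExp p - Finsupp.single i 1 + Finsupp.single x 1) (1 : k) ∈ I := by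
      refine monomial_mem_of_le (fun v => ?_) hy
      have := hyle v
      simp only [Finsupp.add_apply, Finsupp.single_apply, Finsupp.tsub_apply] at this hi ⊢
      rw [if_neg (Ne.symm hxi)] at hi
      by_cases h : i = v
      · subst h
        rw [if_neg (Ne.symm hxi), if_pos rfl]
        omega
      · rw [if_neg h]
        omega
    have h2 := hI.monomial_mem_of_le_letter hix _ h1
    rwa [tsub_add_cancel_of_le hpi] at h2

/-- The key by which the minimal generators are ordered: degree, then lexicographically. -/
def genKey (m : Fin n →₀ ℕ) : ℕ ×ₗ List (Fin n) := toLex ((sortedVars m).length, sortedVars m)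

lemma genKey_injective : Function.Injective (genKey (n := n)) := fun _ _ h =>
  sortedVars_injective (congrArg Prod.snd (toLex.injective h))

lemma degree_le_of_genKey_le {m m' : Fin n →₀ ℕ} (h : genKey m' ≤ genKey m) :
    m'.degree ≤ m.degree := by
  rw [← length_sortedVars, ← length_sortedVars]
  rcases Prod.Lex.le_iff.1 h with h | h
  · exact h.le
  · exact h.1.le

/-- In equal degrees this is the lexicographic comparison. If `m'` has smaller degree and never
drops below `m`, then a proper prefix of `m` is letterwise at most `m'`, hence in `I` by the Borel
property, against the minimality of `m`. -/
lemma IsBorelFixed.exists_first_drop (hI : IsBorelFixed I) {m m' : Fin n →₀ ℕ}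
    (hm : m ∈ minGens I) (hm' : m' ∈ minGens I) (hlt : genKey m' < genKey m) :
    ∃ l, l < (sortedVars m).length ∧ l < (sortedVars m').length ∧
      letter (sortedVars m') l < letter (sortedVars m) l ∧
      ∀ p < l, letter (sortedVars m) p ≤ letter (sortedVars m') p := by
  classical
  suffices hex : ∃ l, l < (sortedVars m).length ∧ l < (sortedVars m').length ∧
      letter (sortedVars m') l < letter (sortedVars m) l by
    obtain ⟨h1, h2, h3⟩ := Nat.find_spec hex
    refine ⟨Nat.find hex, h1, h2, h3, fun p hp => ?_⟩
    by_contra h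
    exact Nat.find_min hex hp ⟨hp.trans h1, hp.trans h2, not_le.1 h⟩
  rcases Prod.Lex.lt_iff.1 hlt with h | ⟨h1, h2⟩
  · change (sortedVars m').length < (sortedVars m).length at h
    by_contra! hno
    set w := sortedVars m
    set w' := sortedVars m'
    have hF : List.Forall₂ (· ≤ ·) (w.take w'.length) w' := by
      rw [List.forall₂_iff_get]
      refine ⟨by rw [List.length_take, min_eq_left h.le], fun i h1 h2 => ?_⟩
      have := hno i (h2.trans h) h2
      rw [letter_eq (h2.trans h), letter_eq h2] at this
      rw [Fin.le_def, List.get_eq_getElem, List.get_eq_getElem, List.getElem_take]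
      exact this
    have hmem : monomial (wordExp (w.take w'.length)) (1 : k) ∈ I :=
      hI.monomial_mem_of_forall₂ hF (by rw [wordExp_sortedVars]; exact hm'.1)
    have hle : wordExp (w.take w'.length) ≤ m := by
      have h := wordExp_append (w.take w'.length) (w.drop w'.length)
      rw [List.take_append_drop, wordExp_sortedVars] at h
      exact le_iff_exists_add.2 ⟨_, h⟩
    have heq : wordExp (w.take w'.length) = m := le_antisymm hle (hm.2 hmem hle)
    have hlen := congrArg (fun m => Multiset.card (Finsupp.toMultiset m))
      (heq.trans (wordExp_sortedVars m).symm : _ = wordExp w)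
    simp only [toMultiset_wordExp, Multiset.coe_card, List.length_take] at hlen
    omega
  · change (sortedVars m').length = (sortedVars m).length at h1
    change sortedVars m' < sortedVars m at h2
    rcases List.lt_iff_exists.1 h2 with h | ⟨l, hl', hl, -, h⟩
    -- A proper prefix is impossible between words of equal length.
    · exact absurd h.2 (by omega)
    · exact ⟨l, hl, hl', by rw [letter_eq hl, letter_eq hl']; exact h⟩

/-- Lowering the letter of `m` at position `l` to `j` stays in `I`, and a prefix of the new word is
a minimal generator. It is shorter than `m` or lexicographically smaller. Its letters keep their
positions, hence their shifts, so its shift divides `x_v m^{σ(a)}` with `v = j + a_l`. -/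
lemma IsBorelFixed.exists_earlier_gen (hI : IsBorelFixed I) {a : ℕ → ℕ} {m : Fin n →₀ ℕ}
    (hm : m ∈ minGens I) {v : ℕ} (hv : v ∈ colonVars a (sortedVars m)) :
    ∃ m' ∈ minGens I, genKey m' < genKey m ∧
      shiftExp a m' ≤ Finsupp.single v 1 + shiftExp a m := by
  have hw := sortedVars_pairwise m
  obtain ⟨l, j, hl, hj, hlt, rfl⟩ := (mem_colonVars hw).1 hv
  set w := sortedVars m with hwdef
  have hjn : j < n := by rw [letter_eq hl] at hj; exact hj.trans (w[l]).2
  set x : Fin n := ⟨j, hjn⟩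
  have hu : (w.set l x).Pairwise (· ≤ ·) := pairwise_set hw hl hj hlt
  have hF : List.Forall₂ (· ≤ ·) (w.set l x) w := by
    rw [List.forall₂_iff_get]
    refine ⟨by simp, fun i h1 h2 => ?_⟩
    have h3 := letter_set hl x i
    rw [letter_eq h1] at h3
    rw [Fin.le_def, List.get_eq_getElem, List.get_eq_getElem, h3, ← letter_eq h2]
    split_ifs with h
    · subst h; exact hj.le
    · rfl
  obtain ⟨r, hr, hrG⟩ := hI.exists_take_mem_minGens hu
    (hI.monomial_mem_of_forall₂ hF (by rw [hwdef, wordExp_sortedVars]; exact hm.1))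
  have hs : sortedVars (wordExp ((w.set l x).take r)) = (w.set l x).take r :=
    sortedVars_wordExp (hu.sublist (List.take_sublist _ _))
  refine ⟨_, hrG, ?_, fun y => ?_⟩
  · rw [Prod.Lex.lt_iff]
    change (sortedVars (wordExp ((w.set l x).take r))).length < w.length ∨
      (sortedVars (wordExp ((w.set l x).take r))).length = w.length ∧
      sortedVars (wordExp ((w.set l x).take r)) < w
    rw [hs, List.length_take, min_eq_left hr]
    rw [List.length_set] at hr
    rcases hr.lt_or_eq with h | h
    · exact Or.inl h
    · refine Or.inr ⟨h, ?_⟩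
      rw [List.take_of_length_le (by rw [List.length_set, h]), List.lt_iff_exists]
      refine Or.inr ⟨l, by simpa using hl, hl, fun i hi => ?_, ?_⟩
      · rw [List.getElem_set_ne (by omega)]
      · rw [List.getElem_set_self, Fin.lt_def, ← letter_eq hl]
        exact hj
  · rw [shiftExp_apply, hs, Finsupp.add_apply, shiftExp_apply, add_comm]
    refine ((shiftCount_take_le _ _ _ _).trans (shiftCount_set_le a hl x y)).trans ?_
    rw [Finsupp.single_apply]
    simp only [eq_comm (a := y)]
    exact le_rfl

end Borel

section Shift

variable {n : ℕ} {I : Ideal (MvPolynomial (Fin n) k)}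

/-! ### Betti numbers of the shifted ideals -/

/-- Dickson's lemma: minimal exponent vectors form an antichain in a well-quasi-order. -/
lemma finite_minGens (I : Ideal (MvPolynomial (Fin n) k)) : (minGens I).Finite :=
  WellQuasiOrderedLE.finite_of_isAntichain (setOfPred_minimal_antichain _)

/-- The exponent vector of `m^{σ(a)}` in the variables `x_0, …, x_{N-1}`. -/
def shiftExpFin (a : ℕ → ℕ) (N : ℕ) (m : Fin n →₀ ℕ) : Fin N →₀ ℕ :=
  Finsupp.comapDomain Fin.val (shiftExp a m) Fin.val_injective.injOn

lemma shiftExpFin_apply (a : ℕ → ℕ) (N : ℕ) (m : Fin n →₀ ℕ) (v : Fin N) :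
    shiftExpFin a N m v = shiftExp a m v := rfl

lemma mapDomain_shiftExpFin {a : ℕ → ℕ} {N : ℕ} (hN : EnoughVars a I N) {m : Fin n →₀ ℕ}
    (hm : m ∈ minGens I) : Finsupp.mapDomain Fin.val (shiftExpFin a N m) = shiftExp a m :=
  Finsupp.mapDomain_comapDomain _ Fin.val_injective _ fun v hv => ⟨⟨v, hN m hm v hv⟩, rfl⟩

lemma degree_shiftExpFin {a : ℕ → ℕ} {N : ℕ} (hN : EnoughVars a I N) {m : Fin n →₀ ℕ}
    (hm : m ∈ minGens I) : (shiftExpFin a N m).degree = m.degree := by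
  rw [← Finsupp.degree_mapDomain Fin.val, mapDomain_shiftExpFin hN hm, degree_shiftExp]

lemma shiftIdeal_eq_span {a : ℕ → ℕ} {N : ℕ} (hN : EnoughVars a I N) :
    shiftIdeal a N I =
      Ideal.span ((fun t => monomial t (1 : k)) '' (shiftExpFin a N '' minGens I)) := by
  rw [shiftIdeal]
  congr 1
  ext f
  constructor
  · rintro ⟨m, hm, t, ht, rfl⟩
    refine ⟨t, ⟨m, hm, ?_⟩, rfl⟩
    rw [← mapDomain_shiftExpFin hN hm] at ht
    exact (Finsupp.mapDomain_injective Fin.val_injective ht).symm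
  · rintro ⟨_, ⟨m, hm, rfl⟩, rfl⟩
    exact ⟨m, hm, _, mapDomain_shiftExpFin hN hm, rfl⟩

/-- Such a variable `j + a_l` has smaller index than the variable at position `l` of `m^{σ(a)}`, so
`T` already contains it. -/
lemma lt_of_mem_colonVars {a : ℕ → ℕ} {N : ℕ} (hN : EnoughVars a I N) {m : Fin n →₀ ℕ}
    (hm : m ∈ minGens I) {v : ℕ} (hv : v ∈ colonVars a (sortedVars m)) : v < N := by
  obtain ⟨l, j, hl, hj, -, rfl⟩ := (mem_colonVars (sortedVars_pairwise m)).1 hv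
  have := hN m hm _ (letter_add_mem_support a m hl)
  omega

/-- The ideal generated by the shifts of the generators preceding `m` has a colon ideal with
respect to the shift of `m` that is generated by the variables in `colonVars`. -/
lemma IsBorelFixed.exists_shift_le_iff (hI : IsBorelFixed I) {a : ℕ → ℕ} (ha : Monotone a) {N : ℕ}
    (hN : EnoughVars a I N) {m : Fin n →₀ ℕ} (hm : m ∈ minGens I) {S : Finset (Fin n →₀ ℕ)}
    (hS : ∀ m', m' ∈ S ↔ m' ∈ minGens I ∧ genKey m' < genKey m) (s : Fin N →₀ ℕ) :
    (∃ t' ∈ shiftExpFin a N '' (S : Set (Fin n →₀ ℕ)), t' ≤ s + shiftExpFin a N m) ↔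
      ∃ v ∈ (colonVars a (sortedVars m)).attachFin fun _ => lt_of_mem_colonVars hN hm,
        s v ≠ 0 := by
  constructor
  · rintro ⟨_, ⟨m', hm', rfl⟩, hle⟩
    obtain ⟨hm'G, hlt⟩ := (hS m').1 hm'
    obtain ⟨l, hl, hl', hd, hmin⟩ := hI.exists_first_drop hm hm'G hlt
    obtain ⟨hc, hcount⟩ := shiftCount_lt_of_first_drop ha (sortedVars_pairwise m)
      (sortedVars_pairwise m') hl hl' hd hmin
    -- The variable at the first drop must divide `s`, since its exponent is larger in the shift of
    -- `m'` than in that of `m`.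
    refine ⟨⟨_, lt_of_mem_colonVars hN hm hc⟩, Finset.mem_attachFin _ |>.2 hc, fun h0 => ?_⟩
    have := hle ⟨_, lt_of_mem_colonVars hN hm hc⟩
    rw [Finsupp.add_apply, h0, zero_add, shiftExpFin_apply, shiftExpFin_apply, shiftExp_apply,
      shiftExp_apply] at this
    exact absurd this (not_le.2 hcount)
  · rintro ⟨v, hv, hsv⟩
    obtain ⟨m', hm'G, hlt, hle⟩ := hI.exists_earlier_gen hm (Finset.mem_attachFin _ |>.1 hv)
    refine ⟨_, ⟨m', (hS m').2 ⟨hm'G, hlt⟩, rfl⟩, fun x => ?_⟩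
    have := hle x
    rw [Finsupp.add_apply, Finsupp.single_apply] at this
    rw [Finsupp.add_apply, shiftExpFin_apply, shiftExpFin_apply]
    refine this.trans (add_le_add ?_ le_rfl)
    split_ifs with h
    · rw [← Fin.ext h]
      exact Nat.one_le_iff_ne_zero.2 hsv
    · exact Nat.zero_le _

/-- The graded Betti numbers of the shifted ideal do not depend on the shifting sequence. -/
theorem IsBorelFixed.hasBetti_shiftIdeal (hI : IsBorelFixed I) {a : ℕ → ℕ} (ha : Monotone a)
    {N : ℕ} (hN : EnoughVars a I N) :
    HasBetti (shiftIdeal a N I) fun i j => ∑ m ∈ (finite_minGens I).toFinset,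
      if j = m.degree + i then (lastLetter (sortedVars m)).choose i else 0 := by
  classical
  -- Induction over initial segments of the generators for `genKey`, adding the largest one last.
  suffices H : ∀ S : Finset (Fin n →₀ ℕ), (∀ m ∈ S, m ∈ minGens I) →
      (∀ m ∈ S, ∀ m' ∈ minGens I, genKey m' < genKey m → m' ∈ S) →
      HasBetti (Ideal.span ((fun t => monomial t (1 : k)) ''
        (shiftExpFin a N '' (S : Set (Fin n →₀ ℕ))))) fun i j => ∑ m ∈ S,
          if j = m.degree + i then (lastLetter (sortedVars m)).choose i else 0 by
    have := H (finite_minGens I).toFinset (by simp) (fun _ _ m' hm' _ => by simpa using hm')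
    rwa [Set.Finite.coe_toFinset, ← shiftIdeal_eq_span hN] at this
  intro S
  induction S using Finset.induction_on_max_value genKey with
  | empty =>
    intro _ _
    simpa using hasBetti_bot
  | insert m S hmS hmax ih =>
    intro hG hlow
    have hm : m ∈ minGens I := hG m (Finset.mem_insert_self _ _)
    have hlt : ∀ m' ∈ S, genKey m' < genKey m := fun m' hm' =>
      (hmax m' hm').lt_of_ne fun h => hmS (genKey_injective h ▸ hm')
    have hS : ∀ m', m' ∈ S ↔ m' ∈ minGens I ∧ genKey m' < genKey m := fun m' =>
      ⟨fun h => ⟨hG m' (Finset.mem_insert_of_mem h), hlt m' h⟩, fun h =>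
        Finset.mem_of_mem_insert_of_ne (hlow m (Finset.mem_insert_self _ _) m' h.1 h.2)
          fun e => h.2.ne (congrArg _ e)⟩
    have h := (ih (fun m' h => ((hS m').1 h).1) fun m₁ h₁ m' hm' h' =>
      (hS m').2 ⟨hm', h'.trans (hlt m₁ h₁)⟩).sup_monomial (shiftExpFin a N m) _
      (hI.exists_shift_le_iff ha hN hm hS) (fun i j hj => by
        obtain ⟨m', hm', hne⟩ := Finset.exists_ne_zero_of_sum_ne_zero hj
        have hj' : j = m'.degree + i := by
          by_contra h
          exact hne (if_neg h)
        have := degree_le_of_genKey_le (hmax m' hm')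
        rw [degree_shiftExpFin hN hm]
        omega)
    rw [Finset.coe_insert, Set.image_insert_eq]
    convert h using 3 with i j
    rw [Finset.sum_insert hmS, add_comm, degree_shiftExpFin hN hm, Finset.card_attachFin,
      card_colonVars ha]

/-! ### The zero sequence and the comparison with the original ideal -/

lemma shiftExp_zero (m : Fin n →₀ ℕ) :
    shiftExp (fun _ => 0) m = Finsupp.mapDomain Fin.val m := by
  conv_rhs => rw [← wordExp_sortedVars m, wordExp, ← Fin.sum_univ_fun_getElem,
    Finsupp.mapDomain_finsetSum]
  simp [shiftExp, Finsupp.mapDomain_single]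

lemma enoughVars_zero (I : Ideal (MvPolynomial (Fin n) k)) : EnoughVars (fun _ => 0) I n := by
  classical
  intro m _ v hv
  rw [shiftExp_zero] at hv
  obtain ⟨x, -, rfl⟩ := Finset.mem_image.1 (Finsupp.mapDomain_support hv)
  exact x.2

lemma shiftExpFin_zero (m : Fin n →₀ ℕ) : shiftExpFin (fun _ => 0) n m = m := by
  ext v
  rw [shiftExpFin_apply, shiftExp_zero, Finsupp.mapDomain_apply Fin.val_injective]

lemma IsMonomialIdeal.span_minGens (hI : IsMonomialIdeal I) :
    Ideal.span ((fun t => monomial t (1 : k)) '' minGens I) = I := by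
  obtain ⟨A, hA⟩ := hI
  apply le_antisymm
  · rw [Ideal.span_le]
    rintro _ ⟨m, hm, rfl⟩
    exact hm.1
  · conv_lhs => rw [hA]
    rw [Ideal.span_le]
    rintro _ ⟨m, hm, rfl⟩
    have hmI : monomial m (1 : k) ∈ I := by
      rw [hA]
      exact Ideal.subset_span ⟨m, hm, rfl⟩
    obtain ⟨g, hgm, hg⟩ := exists_minimal_le_of_wellFoundedLT
      (fun m' : Fin n →₀ ℕ => monomial m' (1 : k) ∈ I) m hmI
    exact monomial_mem_of_le hgm (Ideal.subset_span ⟨g, hg, rfl⟩)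

lemma IsBorelFixed.shiftIdeal_zero (hI : IsBorelFixed I) : shiftIdeal (fun _ => 0) n I = I := by
  rw [shiftIdeal_eq_span (enoughVars_zero I)]
  simp only [shiftExpFin_zero, Set.image_id']
  exact hI.1.span_minGens

/-- Both sides are given by the same sum over generators, the left one through the zero sequence. -/
theorem IsBorelFixed.gradedBetti_shiftIdeal (hI : IsBorelFixed I) {a : ℕ → ℕ} (ha : Monotone a)
    {N : ℕ} (hN : EnoughVars a I N) (i : ℕ) (j : ℤ) :
    gradedBetti I i j = gradedBetti (shiftIdeal a N I) i j := by
  have h₀ := hI.hasBetti_shiftIdeal (a := fun _ => 0) monotone_const (enoughVars_zero I)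
  rw [hI.shiftIdeal_zero] at h₀
  rw [h₀.gradedBetti_eq, (hI.hasBetti_shiftIdeal ha hN).gradedBetti_eq]

end Shift

end BorelFixed

end

theorem corollary4p2 {k : Type*} [Field k] {n : ℕ} (I : Ideal (MvPolynomial (Fin n) k))
    (hI : BorelFixed.IsBorelFixed I) :
    (∀ a : ℕ → ℕ, Monotone a → a 0 = 0 → ∀ N : ℕ, BorelFixed.EnoughVars a I N →
      ∀ (i : ℕ) (j : ℤ),
        BorelFixed.gradedBetti I i j =
          BorelFixed.gradedBetti (BorelFixed.shiftIdeal a N I) i j) ∧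
    (∀ N : ℕ, BorelFixed.EnoughVars (fun i => i) I N →
      ∀ (i : ℕ) (j : ℤ),
        BorelFixed.gradedBetti I i j =
          BorelFixed.gradedBetti (BorelFixed.squarefreeIdeal N I) i j) := by
  exact ⟨fun a ha _ N hN i j => hI.gradedBetti_shiftIdeal ha hN i j,
    fun N hN i j => hI.gradedBetti_shiftIdeal monotone_id hN i j⟩
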